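/- Let $S$ be a finite-level quantum system with Hilbert space $\mathbb C^{d}$ and reference basis $\{|i\rangle\}$, and let $E$ be an environment with an arbitrary (finite- or infinite-dimensional) complex Hilbert space. Let $V_i$ be unitary operators on $E$ (one for each $i$), let $U_{SE}=\sum_i |i\rangle\langle i|\otimes V_i$, let $\rho_E$ be a density operator on $E$, and let $|\psi\rangle=\sum_i c_i|i\rangle$ be a unit vector of $S$. Consider the evolved state $$\rho_{SE}=U_{SE}\,\bigl(|\psi\rangle\langle\psi|\otimes\rho_E\bigr)\,U_{SE}^\dagger=\sum_{i,j}c_i\overline{c_j}\,|i\rangle\langle j|\otimes V_i\rho_E V_j^\dagger .$$ Let $I=\{i: c_i\neq 0\}$ (so $I$ is the set of all indices when every $c_i$ is nonzero). Then the following are equivalent: 1. $\rho_{SE}$ is separable, i.e. it lies in the closed convex hull of the product states $\sigma_S\otimes\sigma_E$. 2. $\rho_{SE}$ is zero-discordant from $E$ to $S$, i.e. there is a rank-one projective measurement $M_n=|e_n\rangle\langle e_n|$ on $E$, with $\{|e_n\rangle\}$ an orthonormal basis of $E$, such that $\sum_n(\mathbb 1\otimes M_n)\,\rho_{SE}\,(\mathbb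 1\otimes M_n)=\rho_{SE}$. 3. $[V_i\rho_EV_j^\dagger,\;V_k\rho_EV_l^\dagger]=0$ for all $i,j,k,l\in I$. 4. There is an operator $R$ on $E$ such that $V_i\rho_EV_i^\dagger=R$ for all $i\in I$ (the qubit-like condition) and $R\,[V_iV_j^\dagger,\;V_kV_l^\dagger]\,R=0$ for all $i,j,k,l\in I$ (the corrected qutrit-like condition). -/

import Mathlib

namespace PureDephasing

open scoped Matrix ComplexOrder

noncomputable section

/-- Operators on the joint Hilbert space `ℂ^ι ⊗ E` of a finite-level system `S` with reference
basis `|i⟩`, `i : ι`, and an environment with Hilbert space `E`. Such an operator `A` is recorded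
by its blocks `A i j = ⟨i| A |j⟩`, which are bounded operators on `E`. Matrix multiplication and
`ᴴ` are the composition and the adjoint of operators on `ℂ^ι ⊗ E`, and the entrywise topology is
the operator norm topology. -/
abbrev JointOp (ι E : Type*) [NormedAddCommGroup E] [InnerProductSpace ℂ E] :=
  Matrix ι ι (E →L[ℂ] E)

/-- The operator `a ⊗ b` on `ℂ^ι ⊗ E`: its `(i, j)` block is `a i j • b`. -/
def tensorOp {ι E : Type*} [NormedAddCommGroup E] [InnerProductSpace ℂ E]
    (a : Matrix ι ι ℂ) (b : E →L[ℂ] E) : JointOp ι E :=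
  Matrix.of fun i j => a i j • b

/-- Density operators (states) on a complex Hilbert space: positive operators of trace one.
(For a positive operator the trace does not depend on the orthonormal basis.) -/
def IsDensityOp {E : Type*} [NormedAddCommGroup E] [InnerProductSpace ℂ E]
    (ρ : E →L[ℂ] E) : Prop :=
  ρ.IsPositive ∧
    ∀ (s : Set E) (e : HilbertBasis s ℂ E), HasSum (fun n => inner ℂ (e n) (ρ (e n))) 1

/-- Density matrices (states) of the finite-level system. -/
def IsDensityMatrix {ι : Type*} [Fintype ι] (a : Matrix ι ι ℂ) : Prop :=
  a.PosSemidef ∧ a.trace = 1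

/-- The pure state `|ψ⟩⟨ψ|` with `|ψ⟩ = ∑ i, c i |i⟩`. -/
def pureState {ι : Type*} (c : ι → ℂ) : Matrix ι ι ℂ :=
  Matrix.vecMulVec c (star c)

/-- The pure-dephasing evolution `U = ∑ i, |i⟩⟨i| ⊗ V i`. -/
def dephasingU {ι E : Type*} [Fintype ι] [DecidableEq ι]
    [NormedAddCommGroup E] [InnerProductSpace ℂ E] (V : ι → E →L[ℂ] E) : JointOp ι E :=
  ∑ i, tensorOp (Matrix.single i i 1) (V i)

/-- The evolved joint state `U (ρS ⊗ ρE) U†`. -/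
def evolvedState {ι E : Type*} [Fintype ι] [DecidableEq ι]
    [NormedAddCommGroup E] [InnerProductSpace ℂ E] [CompleteSpace E]
    (V : ι → E →L[ℂ] E) (ρS : Matrix ι ι ℂ) (ρE : E →L[ℂ] E) : JointOp ι E :=
  dephasingU V * tensorOp ρS ρE * (dephasingU V)ᴴ

/-- The product states `a ⊗ b`, with `a` a state of the system and `b` a state of the
environment. -/
def productStates (ι E : Type*) [Fintype ι] [NormedAddCommGroup E] [InnerProductSpace ℂ E] :
    Set (JointOp ι E) :=
  {σ | ∃ (a : Matrix ι ι ℂ) (b : E →L[ℂ] E),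
    IsDensityMatrix a ∧ IsDensityOp b ∧ σ = tensorOp a b}

/-- Separability of a joint state: it is a limit of finite convex mixtures of product states.
On density operators, operator-norm convergence to a density operator is the same as convergence
in trace norm, so this is the usual closed convex hull; if `E` is finite-dimensional then the
convex hull is already closed, and `ρ` is a finite mixture of product states. -/
def IsSeparableState {ι E : Type*} [Fintype ι] [NormedAddCommGroup E] [InnerProductSpace ℂ E]
    (ρ : JointOp ι E) : Prop :=
  ρ ∈ closure (convexHull ℝ (productStates ι E))

/-- Zero discord from `E` to `S`: some rank-one projective measurement `M n = |e n⟩⟨e n|` on `E`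
(`e` an orthonormal basis of `E`) leaves the joint state unchanged,
`∑ n, (1 ⊗ M n) ρ (1 ⊗ M n) = ρ`. (For trace-class `ρ` the sum always converges, in trace norm
and hence in operator norm.) -/
def IsZeroDiscordEtoS {ι E : Type*} [Fintype ι] [DecidableEq ι]
    [NormedAddCommGroup E] [InnerProductSpace ℂ E] (ρ : JointOp ι E) : Prop :=
  ∃ (s : Set E) (e : HilbertBasis s ℂ E),
    HasSum (fun n => tensorOp (1 : Matrix ι ι ℂ) (InnerProductSpace.rankOne ℂ (e n) (e n)) * ρ *
      tensorOp (1 : Matrix ι ι ℂ) (InnerProductSpace.rankOne ℂ (e n) (e n))) ρ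

end

end PureDephasing

/-! ### Orthonormal bases, Hilbert–Schmidt square roots and compactness of density operators. -/

namespace PureDephasing

open scoped Matrix ComplexOrder
open Filter Topology InnerProductSpace

variable {ι E : Type*} [NormedAddCommGroup E] [InnerProductSpace ℂ E]

/-! Write `A i j = V i * ρ * star (V j)` and `W i j = V i * star (V j)`. The cycle is 1 → 4 → 3 → 2
→ 1.

1 → 4: a separable state has positive partial transpose. Well-chosen test vectors give expectations
that are nonnegative and sum to `1 - 1 - 1 + 1 = 0` along an orthonormal basis, because each term is
a trace of `ρ`. They are therefore null vectors, and by Cauchy–Schwarz the partial transpose kills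
them: `A i j = A k j * W i k` (`IsSeparableState.twist`). Taking `j = i` yields the common `R`; then
`A i j = R * W i j = W i j * R`, and the relation says that the `W`s commute after left
multiplication by `R` (`mul_lie_mul_eq_zero_of_twist`).

4 → 3: `A i j * A k l = R * W i j * W k l * R`.

3 → 2: the blocks are compact and commute, and all vanish on the kernel of one diagonal block, so
they share an orthonormal eigenbasis (`exists_joint_eigenbasis`). Measuring in it changes nothing.

2 → 1: each measured term is a positive matrix tensored with `|e n⟩⟨e n|`, and the traces sum to
one. -/

lemma tensorOp_apply (a : Matrix ι ι ℂ) (b : E →L[ℂ] E) (i j : ι) :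
    tensorOp a b i j = a i j • b := rfl

lemma dephasingU_eq_diagonal [Fintype ι] [DecidableEq ι] (V : ι → E →L[ℂ] E) :
    dephasingU V = Matrix.diagonal V := by
  ext1 i j
  simp only [dephasingU, Matrix.sum_apply, tensorOp_apply, Matrix.single_apply,
    Matrix.diagonal_apply, ite_smul, one_smul, zero_smul]
  by_cases h : i = j
  · subst h; simp
  · rw [if_neg h]
    refine Finset.sum_eq_zero fun k _ => if_neg ?_
    rintro ⟨rfl, rfl⟩
    exact h rfl

lemma evolvedState_apply [Fintype ι] [DecidableEq ι] [CompleteSpace E]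
    (V : ι → E →L[ℂ] E) (ρS : Matrix ι ι ℂ) (ρE : E →L[ℂ] E) (i j : ι) :
    evolvedState V ρS ρE i j = ρS i j • (V i * ρE * star (V j)) := by
  rw [evolvedState, dephasingU_eq_diagonal, Matrix.diagonal_conjTranspose, Matrix.mul_diagonal,
    Matrix.diagonal_mul, tensorOp_apply]
  simp

lemma pureState_apply (c : ι → ℂ) (i j : ι) : pureState c i j = c i * star (c j) := rfl

/-- A Hilbert basis reindexed by its range. -/
lemma exists_hilbertBasis_subtype {κ : Type*} {v : κ → E} (hv : Orthonormal ℂ v)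
    [CompleteSpace E] (hsp : (Submodule.span ℂ (Set.range v))ᗮ = ⊥) :
    ∃ e : HilbertBasis (Set.range v) ℂ E, ∀ n, e n = n := by
  have h := hv.toSubtypeRange
  refine ⟨HilbertBasis.mkOfOrthogonalEqBot h (by rwa [Subtype.range_coe]), fun n => ?_⟩
  simp

/-- The definition only tests bases indexed by subsets of `E`; passing to the range of the basis
frees the index type. -/
lemma IsDensityOp.hasSum_inner [CompleteSpace E] {ρ : E →L[ℂ] E} (hρ : IsDensityOp ρ)
    {κ : Type*} (b : HilbertBasis κ ℂ E) : HasSum (fun n => inner ℂ (b n) (ρ (b n))) 1 := by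
  have hb : (Submodule.span ℂ (Set.range b))ᗮ = ⊥ :=
    (Submodule.topologicalClosure_eq_top_iff).1 b.dense_span
  obtain ⟨e, he⟩ := exists_hilbertBasis_subtype b.orthonormal hb
  have h := hρ.2 _ e
  simp only [he] at h
  have := (Equiv.ofInjective b b.orthonormal.linearIndependent.injective).hasSum_iff.2 h
  simpa [Function.comp_def] using this

/-- The image of a Hilbert basis under a unitary operator. -/
lemma exists_hilbertBasis_unitary [CompleteSpace E] {κ : Type*} (b : HilbertBasis κ ℂ E)
    {U : E →L[ℂ] E} (hU : U ∈ unitary (E →L[ℂ] E)) :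
    ∃ e : HilbertBasis κ ℂ E, ∀ n, e n = U (b n) := by
  classical
  let L : E ≃ₗᵢ[ℂ] E := Unitary.linearIsometryEquiv ⟨U, hU⟩
  refine ⟨HilbertBasis.ofRepr (L.symm.trans b.repr), fun n => ?_⟩
  rw [← HilbertBasis.repr_symm_single, ← HilbertBasis.repr_symm_single]
  rfl

lemma IsDensityOp.hasSum_inner_unitary [CompleteSpace E] {ρ : E →L[ℂ] E} (hρ : IsDensityOp ρ)
    {κ : Type*} (b : HilbertBasis κ ℂ E) {U : E →L[ℂ] E} (hU : U ∈ unitary (E →L[ℂ] E)) :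
    HasSum (fun n => inner ℂ (U (b n)) (ρ (U (b n)))) 1 := by
  obtain ⟨e, he⟩ := exists_hilbertBasis_unitary b hU
  simpa [he] using hρ.hasSum_inner e

lemma eq_of_forall_hilbertBasis {κ F : Type*} [NormedAddCommGroup F] [NormedSpace ℂ F]
    (b : HilbertBasis κ ℂ E) {S T : E →L[ℂ] F}
    (h : ∀ n, S (b n) = T (b n)) : S = T := by
  have hd : Dense (Submodule.span ℂ (Set.range b) : Set E) :=
    (Submodule.dense_iff_topologicalClosure_eq_top).2 b.dense_span
  refine ContinuousLinearMap.ext_on hd ?_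
  rintro _ ⟨n, rfl⟩
  exact h n

/-- An operator which is Hilbert–Schmidt with respect to `b` is the norm-convergent sum of its
compositions with the rank-one projections of `b`. -/
lemma hasSum_mul_rankOne {κ : Type*} (b : HilbertBasis κ ℂ E) {T : E →L[ℂ] E}
    (hT : Summable fun n => ‖T (b n)‖ ^ 2) :
    HasSum (fun n => T * rankOne ℂ (b n) (b n)) T := by
  classical
  rw [HasSum, SummationFilter.unconditional_filter, Metric.tendsto_atTop]
  intro ε hε
  -- A tail of squares below `(ε / 2) ^ 2`, with Cauchy–Schwarz and Bessel, bounds the tail of `T x`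
  -- by `ε / 2 * ‖x‖` uniformly in `x`.
  obtain ⟨s, hs⟩ := summable_iff_vanishing_norm.1 hT (ε ^ 2 / 4) (by positivity)
  refine ⟨s, fun t ht => ?_⟩
  rw [dist_comm, dist_eq_norm]
  refine lt_of_le_of_lt (b := ε / 2) ?_ (by linarith)
  refine ContinuousLinearMap.opNorm_le_bound _ (by positivity) fun x => ?_
  have hx : HasSum (fun n => inner ℂ (b n) x • T (b n)) (T x) := by
    simpa [HilbertBasis.repr_apply_apply] using (b.hasSum_repr x).mapL T
  have hx' : Tendsto (fun u : Finset κ => ∑ n ∈ u \ t, inner ℂ (b n) x • T (b n)) atTop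
      (𝓝 (T x - ∑ n ∈ t, inner ℂ (b n) x • T (b n))) := by
    have := (Filter.Tendsto.sub_const hx (∑ n ∈ t, inner ℂ (b n) x • T (b n)))
    refine this.congr' ?_
    filter_upwards [eventually_ge_atTop t] with u hu
    rw [← Finset.sum_sdiff hu, add_sub_cancel_right]
  have heq : (T - ∑ n ∈ t, T * rankOne ℂ (b n) (b n)) x
      = T x - ∑ n ∈ t, inner ℂ (b n) x • T (b n) := by
    simp
  rw [heq]
  refine le_of_tendsto hx'.norm (Eventually.of_forall fun u => ?_)
  have h1 : ∑ n ∈ u \ t, ‖T (b n)‖ ^ 2 ≤ (ε / 2) ^ 2 := by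
    have := hs (u \ t) (Finset.disjoint_sdiff.mono_left ht).symm
    rw [Real.norm_of_nonneg (by positivity)] at this
    nlinarith
  have h2 : ∑ n ∈ u \ t, ‖inner ℂ (b n) x‖ ^ 2 ≤ ‖x‖ ^ 2 :=
    b.orthonormal.sum_inner_products_le x
  calc ‖∑ n ∈ u \ t, inner ℂ (b n) x • T (b n)‖
      ≤ ∑ n ∈ u \ t, ‖T (b n)‖ * ‖inner ℂ (b n) x‖ :=
        (norm_sum_le _ _).trans (Finset.sum_le_sum fun n _ => by rw [norm_smul, mul_comm])
    _ ≤ √(∑ n ∈ u \ t, ‖T (b n)‖ ^ 2) * √(∑ n ∈ u \ t, ‖inner ℂ (b n) x‖ ^ 2) :=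
        Real.sum_mul_le_sqrt_mul_sqrt _ _ _
    _ ≤ √((ε / 2) ^ 2) * √(‖x‖ ^ 2) := by gcongr
    _ = ε / 2 * ‖x‖ := by rw [Real.sqrt_sq (by positivity), Real.sqrt_sq (by positivity)]

/-- A density operator is the square of a self-adjoint operator that is Hilbert–Schmidt in every
basis. -/
lemma IsDensityOp.exists_sqrt [CompleteSpace E] {ρ : E →L[ℂ] E} (hρ : IsDensityOp ρ) :
    ∃ T : E →L[ℂ] E, T * T = ρ ∧ ∀ {κ : Type _} (b : HilbertBasis κ ℂ E),
      Summable fun n => ‖T (b n)‖ ^ 2 := by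
  have h0 : 0 ≤ ρ := (ContinuousLinearMap.nonneg_iff_isPositive ρ).2 hρ.1
  refine ⟨CFC.sqrt ρ, CFC.sqrt_mul_sqrt_self ρ h0, fun {κ} b => ?_⟩
  have hs : (CFC.sqrt ρ).IsPositive :=
    (ContinuousLinearMap.nonneg_iff_isPositive _).1 (CFC.sqrt_nonneg ρ)
  have h := (Complex.hasSum_re (hρ.hasSum_inner b)).summable
  refine h.congr fun n => ?_
  have hn : ρ (b n) = CFC.sqrt ρ (CFC.sqrt ρ (b n)) := by
    conv_lhs => rw [← CFC.sqrt_mul_sqrt_self ρ h0]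
    rfl
  rw [hn, ← hs.inner_left_eq_inner_right, inner_self_eq_norm_sq_to_K]
  norm_cast

lemma isCompactOperator_rankOne (x y : E) : IsCompactOperator (rankOne ℂ x y) := by
  rw [rankOne_def']
  exact (isCompactOperator_of_locallyCompactSpace_dom (innerSL ℂ y)).clm_comp
    (ContinuousLinearMap.toSpanSingleton ℂ x)

/-- The square root is Hilbert–Schmidt, hence a norm limit of finite-rank operators, and `ρ` is its
square. -/
lemma IsDensityOp.isCompactOperator [CompleteSpace E] {ρ : E →L[ℂ] E} (hρ : IsDensityOp ρ) :
    IsCompactOperator ρ := by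
  obtain ⟨T, hT, hsum⟩ := hρ.exists_sqrt
  obtain ⟨w, b, -⟩ := exists_hilbertBasis ℂ E
  have h := hasSum_mul_rankOne b (hsum b)
  have hc : IsCompactOperator T := by
    refine isCompactOperator_of_tendsto h (Eventually.of_forall fun t => ?_)
    refine Submodule.sum_mem (compactOperator (RingHom.id ℂ) E E) fun n _ => ?_
    exact (isCompactOperator_rankOne (b n) (b n)).clm_comp T
  rw [← hT]
  exact hc.clm_comp T

end PureDephasing

/-! ### Partial transpose and the Peres criterion. -/

namespace PureDephasing

open scoped Matrix ComplexOrder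
open Filter Topology InnerProductSpace

variable {ι E : Type*} [NormedAddCommGroup E] [InnerProductSpace ℂ E]

lemma conj_rankOne_eq {e : E} (he : ‖e‖ = 1) {A : E →L[ℂ] E} {a : ℂ} (h : A e = a • e) :
    rankOne ℂ e e * A * rankOne ℂ e e = A * rankOne ℂ e e := by
  have hA : A * rankOne ℂ e e = a • rankOne ℂ e e := by
    ext x
    simp only [mul_apply_eq_comp, rankOne_apply, smul_apply, map_smul, h]
    exact smul_comm _ _ _
  have := (isIdempotentElem_rankOne_self (𝕜 := ℂ) he).eq
  rw [mul_assoc, hA, mul_smul_comm, this]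

lemma tensorOp_one_mul_mul_apply [Fintype ι] [DecidableEq ι] (P : E →L[ℂ] E) (σ : JointOp ι E) (i j : ι) :
    (tensorOp (1 : Matrix ι ι ℂ) P * σ * tensorOp (1 : Matrix ι ι ℂ) P) i j
      = P * σ i j * P := by
  have : tensorOp (1 : Matrix ι ι ℂ) P = Matrix.diagonal fun _ => P := by
    ext1 i j
    rw [tensorOp_apply, Matrix.one_apply, Matrix.diagonal_apply]
    split_ifs <;> simp
  rw [this, Matrix.mul_diagonal, Matrix.diagonal_mul]

/-- The sesquilinear form of the partial transpose of a joint operator with respect to the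
system. -/
noncomputable def transposeForm [Fintype ι] (σ : JointOp ι E) (x y : ι → E) : ℂ :=
  ∑ i, ∑ j, inner ℂ (x i) (σ j i (y j))

section transposeForm

variable [Fintype ι] (σ : JointOp ι E)

lemma transposeForm_add_left (x x' y : ι → E) :
    transposeForm σ (x + x') y = transposeForm σ x y + transposeForm σ x' y := by
  simp [transposeForm, Finset.sum_add_distrib]

lemma transposeForm_add_right (x y y' : ι → E) :
    transposeForm σ x (y + y') = transposeForm σ x y + transposeForm σ x y' := by
  simp [transposeForm, Finset.sum_add_distrib]

lemma transposeForm_smul_left (a : ℂ) (x y : ι → E) :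
    transposeForm σ (a • x) y = star a * transposeForm σ x y := by
  simp [transposeForm, Finset.sum_mul, mul_comm]

lemma transposeForm_smul_right (a : ℂ) (x y : ι → E) :
    transposeForm σ x (a • y) = a * transposeForm σ x y := by
  simp [transposeForm, Finset.mul_sum]

lemma transposeForm_single_left [DecidableEq ι] (i : ι) (a : E) (y : ι → E) :
    transposeForm σ (Pi.single i a) y = ∑ j, inner ℂ a (σ j i (y j)) := by
  rw [transposeForm, Finset.sum_eq_single i]
  · simp
  · intro k _ hk; simp [hk]
  · simp

lemma transposeForm_single_single [DecidableEq ι] (i j : ι) (a b : E) :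
    transposeForm σ (Pi.single i a) (Pi.single j b) = inner ℂ a (σ j i b) := by
  rw [transposeForm_single_left, Finset.sum_eq_single j]
  · simp
  · intro k _ hk; simp [hk]
  · simp

lemma star_transposeForm [CompleteSpace E] (hσ : ∀ i j, star (σ i j) = σ j i) (x y : ι → E) :
    star (transposeForm σ x y) = transposeForm σ y x := by
  simp only [transposeForm, star_sum]
  rw [Finset.sum_comm]
  refine Finset.sum_congr rfl fun i _ => Finset.sum_congr rfl fun j _ => ?_
  rw [← hσ i j, ContinuousLinearMap.star_eq_adjoint, ContinuousLinearMap.adjoint_inner_right]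
  exact inner_conj_symm _ _

/-- The Cauchy–Schwarz argument: null vectors of a positive form lie in its radical. -/
lemma sum_eq_zero_of_transposeForm_eq_zero [DecidableEq ι] [CompleteSpace E]
    (hσ : ∀ i j, star (σ i j) = σ j i) (hpos : ∀ x, 0 ≤ (transposeForm σ x x).re)
    {v : ι → E} (hv : (transposeForm σ v v).re = 0) (i : ι) : ∑ j, σ j i (v j) = 0 := by
  set z := ∑ j, σ j i (v j) with hz
  set w : ι → E := Pi.single i z
  have hwv : transposeForm σ w v = (‖z‖ ^ 2 : ℝ) := by
    rw [transposeForm_single_left, ← inner_sum, ← hz, inner_self_eq_norm_sq_to_K]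
    norm_cast
  have hvw : transposeForm σ v w = (‖z‖ ^ 2 : ℝ) := by
    rw [← star_transposeForm σ hσ, hwv]
    exact Complex.conj_ofReal _
  have key : ∀ t : ℝ, 0 ≤ 2 * t * ‖z‖ ^ 2 + t ^ 2 * (transposeForm σ w w).re := by
    intro t
    have h := hpos (v + (t : ℂ) • w)
    rw [transposeForm_add_left, transposeForm_add_right, transposeForm_add_right,
      transposeForm_smul_left, transposeForm_smul_left, transposeForm_smul_right,
      transposeForm_smul_right, hvw, hwv] at h
    have e : star (t : ℂ) = t := Complex.conj_ofReal _
    rw [e] at h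
    simp only [Complex.add_re, Complex.re_ofReal_mul, Complex.ofReal_re, hv] at h
    nlinarith
  have hq := hpos w
  set q := (transposeForm σ w w).re
  by_contra hne
  have hn : 0 < ‖z‖ ^ 2 := by positivity
  -- The quadratic in `t` is negative for small negative `t`; the `+ 1` keeps the denominator
  -- positive when `q = 0`.
  have h := key (-‖z‖ ^ 2 / (q + 1))
  have hq1 : 0 < q + 1 := by linarith
  have : 2 * (-‖z‖ ^ 2 / (q + 1)) * ‖z‖ ^ 2 + (-‖z‖ ^ 2 / (q + 1)) ^ 2 * q
      = - ((‖z‖ ^ 2) ^ 2 * (q + 2) / (q + 1) ^ 2) := by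
    field_simp
    ring
  rw [this] at h
  have : 0 < (‖z‖ ^ 2) ^ 2 * (q + 2) / (q + 1) ^ 2 := by positivity
  linarith

end transposeForm

/-- The Peres criterion: separable states have positive partial transpose. -/
lemma IsSeparableState.transposeForm_nonneg [Fintype ι] {σ : JointOp ι E}
    (hσ : IsSeparableState σ) (x : ι → E) : 0 ≤ (transposeForm σ x x).re := by
  classical
  have hcont : Continuous fun τ : JointOp ι E => (transposeForm τ x x).re := by
    refine Complex.continuous_re.comp ?_
    refine continuous_finsetSum _ fun i _ => continuous_finsetSum _ fun j _ => ?_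
    refine continuous_const.inner ?_
    exact (ContinuousLinearMap.apply ℂ E (x j)).continuous.comp (continuous_id.matrix_elem j i)
  have hclosed : IsClosed {τ : JointOp ι E | 0 ≤ (transposeForm τ x x).re} :=
    isClosed_le continuous_const hcont
  have hconv : Convex ℝ {τ : JointOp ι E | 0 ≤ (transposeForm τ x x).re} := by
    intro τ hτ τ' hτ' a b ha hb _
    have : (transposeForm (a • τ + b • τ') x x).re
        = a * (transposeForm τ x x).re + b * (transposeForm τ' x x).re := by
      simp [transposeForm, Finset.sum_add_distrib, Finset.mul_sum,
        inner_smul_right_eq_smul]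
    simp only [Set.mem_ofPred_eq] at hτ hτ' ⊢
    rw [this]
    positivity
  refine closure_minimal (convexHull_min ?_ hconv) hclosed hσ
  rintro _ ⟨a, b, ha, hb, rfl⟩
  -- With `a` a sum of `|v k⟩⟨v k|`, the form becomes a sum of expectations of `b` in the vectors `∑
  -- i, v k i • x i`.
  obtain ⟨m, v, rfl⟩ := Matrix.posSemidef_iff_eq_sum_vecMulVec.1 ha.1
  have : transposeForm (tensorOp (∑ k, Matrix.vecMulVec (v k) (star (v k))) b) x x
      = ∑ k, inner ℂ (∑ i, v k i • x i) (b (∑ i, v k i • x i)) := by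
    have hk : ∀ k, inner ℂ (∑ i, v k i • x i) (b (∑ i, v k i • x i))
        = ∑ i, ∑ j, v k j * star (v k i) * inner ℂ (x i) (b (x j)) := by
      intro k
      simp only [map_sum, sum_inner, inner_sum, map_smul, inner_smul_left, inner_smul_right,
        Finset.mul_sum]
      rw [Finset.sum_comm]
      refine Finset.sum_congr rfl fun i _ => Finset.sum_congr rfl fun j _ => ?_
      simp only [RCLike.star_def]
      ring
    simp only [hk, transposeForm, tensorOp_apply, smul_apply,
      inner_smul_right, Matrix.sum_apply, Matrix.vecMulVec_apply, Pi.star_apply, Finset.sum_mul]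
    rw [Finset.sum_congr rfl fun i _ => Finset.sum_comm, Finset.sum_comm]
  rw [Set.mem_ofPred_eq, this, Complex.re_sum]
  exact Finset.sum_nonneg fun k _ => hb.1.re_inner_nonneg_right _

end PureDephasing

/-! ### From separability to commutation of the blocks. -/

namespace PureDephasing

open scoped Matrix ComplexOrder
open Filter Topology InnerProductSpace

variable {ι E : Type*} [NormedAddCommGroup E] [InnerProductSpace ℂ E] [CompleteSpace E]

section evolved

variable [Fintype ι] [DecidableEq ι] {V : ι → E →L[ℂ] E} {ρ : E →L[ℂ] E} {c : ι → ℂ}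

lemma star_evolvedState (hρ : star ρ = ρ) (i j : ι) :
    star (evolvedState V (pureState c) ρ i j) = evolvedState V (pureState c) ρ j i := by
  simp only [evolvedState_apply, pureState_apply, star_smul, star_mul, star_star, hρ, mul_assoc]

/-- Dividing by the amplitudes leaves a form that depends only on `ρ` and the unitaries. -/
lemma inner_evolvedState {i k : ι} (hi : c i ≠ 0) (hk : c k ≠ 0) (x y : E) :
    inner ℂ ((c k)⁻¹ • x) (evolvedState V (pureState c) ρ i k ((c i)⁻¹ • y))
      = inner ℂ (star (V i) x) (ρ (star (V k) y)) := by
  have hk' : star (c k) ≠ 0 := star_ne_zero.2 hk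
  rw [evolvedState_apply, pureState_apply]
  simp only [smul_apply, map_smul, inner_smul_left, inner_smul_right,
    mul_apply_eq_comp, ContinuousLinearMap.star_eq_adjoint,
    ContinuousLinearMap.adjoint_inner_left, map_inv₀]
  rw [← RCLike.star_def]
  field_simp

/-- Positivity of the partial transpose, tested on the vectors
`(c k)⁻¹ |k⟩ ⊗ V i V k† y - (c i)⁻¹ |i⟩ ⊗ y`, whose expectations sum to zero along an orthonormal
basis. -/
lemma IsSeparableState.twist (hV : ∀ i, V i ∈ unitary (E →L[ℂ] E)) (hρ : IsDensityOp ρ)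
    (h : IsSeparableState (evolvedState V (pureState c) ρ)) {i j k : ι}
    (hi : c i ≠ 0) (hj : c j ≠ 0) (hk : c k ≠ 0) :
    V i * ρ * star (V j) = V k * ρ * star (V j) * (V i * star (V k)) := by
  obtain ⟨w, b, -⟩ := exists_hilbertBasis ℂ E
  set σ := evolvedState V (pureState c) ρ with hσ
  have hsa : ∀ i j, star (σ i j) = σ j i := star_evolvedState hρ.1.isSelfAdjoint.star_eq
  -- With this `W`, `star (V i) * W = star (V k)`, so both cross terms of the form reduce to the
  -- same expectation of `ρ`.
  let W := V i * star (V k)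
  let v : E → ι → E := fun y =>
    Pi.single k ((c k)⁻¹ • W y) + Pi.single i ((c i)⁻¹ • (-y))
  have hVV : ∀ i y, star (V i) (V i y) = y := fun i y => by
    rw [← mul_apply_eq_comp, (Unitary.mem_iff.1 (hV i)).1,
      one_apply_eq_self]
  have hW : ∀ y, star (V i) (W y) = star (V k) y := fun y => hVV i _
  have hWu : star (V k) * W ∈ unitary (E →L[ℂ] E) :=
    mul_mem (Unitary.star_mem (hV k)) (mul_mem (hV i) (Unitary.star_mem (hV k)))
  have hform : ∀ y, transposeForm σ (v y) (v y)
      = inner ℂ ((star (V k) * W) y) (ρ ((star (V k) * W) y))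
        - inner ℂ (star (V k) y) (ρ (star (V k) y))
        - inner ℂ (star (V k) y) (ρ (star (V k) y))
        + inner ℂ (star (V i) y) (ρ (star (V i) y)) := by
    intro y
    simp only [v, transposeForm_add_left, transposeForm_add_right, transposeForm_single_single,
      hσ, inner_evolvedState hi hk, inner_evolvedState hk hk, inner_evolvedState hk hi,
      inner_evolvedState hi hi, map_neg, hW, inner_neg_left, inner_neg_right, neg_neg,
      mul_apply_eq_comp]
    ring
  have hsum : HasSum (fun n => (transposeForm σ (v (b n)) (v (b n))).re) 0 := by
    have h1 := ((((hρ.hasSum_inner_unitary b hWu).sub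
      (hρ.hasSum_inner_unitary b (Unitary.star_mem (hV k)))).sub
      (hρ.hasSum_inner_unitary b (Unitary.star_mem (hV k)))).add
      (hρ.hasSum_inner_unitary b (Unitary.star_mem (hV i))))
    have h2 := Complex.hasSum_re h1
    simpa [hform] using h2
  have hzero := (hasSum_zero_iff_of_nonneg fun n => h.transposeForm_nonneg (v (b n))).1 hsum
  refine eq_of_forall_hilbertBasis b fun n => ?_
  -- The `j`-th component of the null-vector equation is `star (c j)` times the difference of the
  -- two sides of the claim.
  have hker := sum_eq_zero_of_transposeForm_eq_zero σ hsa h.transposeForm_nonneg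
    (congrFun hzero n) j
  have hsplit : ∑ l, σ l j (v (b n) l)
      = σ k j ((c k)⁻¹ • W (b n)) + σ i j ((c i)⁻¹ • (-b n)) := by
    simp only [v, Pi.add_apply, map_add, Finset.sum_add_distrib]
    congr 1
    · rw [Finset.sum_eq_single k (by intro l _ hl; simp [hl]) (by simp)]; simp
    · rw [Finset.sum_eq_single i (by intro l _ hl; simp [hl]) (by simp)]; simp
  rw [hsplit, hσ, evolvedState_apply, evolvedState_apply, pureState_apply, pureState_apply] at hker
  have hj' : star (c j) ≠ 0 := star_ne_zero.2 hj
  simp only [smul_apply, map_smul, smul_smul, map_neg, smul_neg] at hker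
  rw [inv_mul_cancel_left₀ hi, inv_mul_cancel_left₀ hk,
    ← sub_eq_add_neg, ← smul_sub, smul_eq_zero, or_iff_right hj', sub_eq_zero] at hker
  exact hker.symm

end evolved

/-- Commuting with `x` after left multiplication by `R` is stable under products, since `R` can be
moved past `y`. -/
lemma mul_mul_comm_mul {A : Type*} [Ring A] {R x y z : A} (hy : R * y = y * R)
    (hxy : R * x * y = R * y * x) (hxz : R * x * z = R * z * x) :
    R * x * (y * z) = R * (y * z) * x := by
  calc R * x * (y * z) = R * x * y * z := by rw [mul_assoc _ y z]
    _ = R * y * x * z := by rw [hxy]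
    _ = y * (R * x * z) := by rw [hy]; simp only [mul_assoc]
    _ = y * R * z * x := by rw [hxz]; simp only [mul_assoc]
    _ = R * (y * z) * x := by rw [← hy]; simp only [mul_assoc]

/-- The same relation passes to inverses. -/
lemma mul_mul_comm_inv {A : Type*} [Ring A] {R x y z : A} (hy : R * y = y * R)
    (hz : R * z = z * R) (hyz : y * z = 1) (hzy : z * y = 1) (hxy : R * x * y = R * y * x) :
    R * x * z = R * z * x := by
  calc R * x * z = z * (y * R) * x * z := by rw [← mul_assoc, hzy, one_mul]
    _ = z * (R * x * y) * z := by rw [hxy, hy]; simp only [mul_assoc]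
    _ = z * R * x := by simp only [mul_assoc, hyz, mul_one]
    _ = R * z * x := by rw [hz]

/-- If the blocks `V i * ρ * star (V j)` satisfy the twist relation, then the operators
`V i * star (V j)` commute up to multiplication by the common conjugate `R` of `ρ`. -/
lemma mul_lie_mul_eq_zero_of_twist {V : ι → E →L[ℂ] E} (hV : ∀ i, V i ∈ unitary (E →L[ℂ] E))
    {ρ : E →L[ℂ] E} {I : Set ι}
    (h : ∀ i ∈ I, ∀ j ∈ I, ∀ k ∈ I,
      V i * ρ * star (V j) = V k * ρ * star (V j) * (V i * star (V k)))
    {R : E →L[ℂ] E} (hR : ∀ i ∈ I, V i * ρ * star (V i) = R) :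
    ∀ i ∈ I, ∀ j ∈ I, ∀ k ∈ I, ∀ l ∈ I, R * ⁅V i * star (V j), V k * star (V l)⁆ = 0 := by
  have hl : ∀ i (x : E →L[ℂ] E), star (V i) * (V i * x) = x := fun i x => by
    rw [← mul_assoc, (Unitary.mem_iff.1 (hV i)).1, one_mul]
  have hr : ∀ i (x : E →L[ℂ] E), V i * (star (V i) * x) = x := fun i x => by
    rw [← mul_assoc, (Unitary.mem_iff.1 (hV i)).2, one_mul]
  have hr' : ∀ i, V i * star (V i) = 1 := fun i => (Unitary.mem_iff.1 (hV i)).2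
  have hA : ∀ i ∈ I, ∀ j ∈ I, V i * ρ * star (V j) = R * (V i * star (V j)) := by
    intro i hi j hj
    rw [← hR i hi]; simp only [mul_assoc, hl]
  have hA' : ∀ i ∈ I, ∀ j ∈ I, V i * ρ * star (V j) = (V i * star (V j)) * R := by
    intro i hi j hj
    rw [← hR j hj]; simp only [mul_assoc, hl]
  have hcomm : ∀ i ∈ I, ∀ j ∈ I, V i * star (V j) * R = R * (V i * star (V j)) :=
    fun i hi j hj => (hA' i hi j hj).symm.trans (hA i hi j hj)
  -- `W i k` and `W k j` commute up to `R`
  have hP : ∀ i ∈ I, ∀ j ∈ I, ∀ k ∈ I,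
      R * (V i * star (V k)) * (V k * star (V j)) = R * (V k * star (V j)) * (V i * star (V k)) := by
    intro i hi j hj k hk
    rw [← hA k hk j hj, ← h i hi j hj k hk, hA i hi j hj]
    simp only [mul_assoc, hl]
  have hinv : ∀ j k, V j * star (V k) * (V k * star (V j)) = 1 := fun j k => by
    rw [mul_assoc, hl, hr']
  intro i hi j hj k hk l hl'
  -- `hP` covers only pairs sharing a middle index. Factoring through `j` reduces the general pair
  -- to these: `W i j` against `W j l`, and against `W k j`, the inverse of `W j k`.
  have hkl : V k * star (V l) = V k * star (V j) * (V j * star (V l)) := by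
    rw [mul_assoc, hl]
  rw [Ring.lie_def, mul_sub, ← mul_assoc R, ← mul_assoc R, sub_eq_zero, hkl]
  refine mul_mul_comm_mul (hcomm k hk j hj).symm ?_ (hP i hi l hl' j hj)
  exact mul_mul_comm_inv (hcomm j hj k hk).symm (hcomm k hk j hj).symm (hinv j k) (hinv k j)
    (hP i hi k hk j hj)

/-- The commutation condition on the blocks, in terms of the common conjugate of the state. -/
lemma lie_eq_zero_of_mul_lie_mul {V : ι → E →L[ℂ] E} (hV : ∀ i, V i ∈ unitary (E →L[ℂ] E))
    {ρ R : E →L[ℂ] E} {i j k l : ι} (hi : V i * ρ * star (V i) = R)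
    (hj : V j * ρ * star (V j) = R) (hk : V k * ρ * star (V k) = R)
    (hl : V l * ρ * star (V l) = R)
    (h : R * ⁅V i * star (V j), V k * star (V l)⁆ * R = 0) :
    ⁅V i * ρ * star (V j), V k * ρ * star (V l)⁆ = 0 := by
  have hc : ∀ i (x : E →L[ℂ] E), star (V i) * (V i * x) = x := fun i x => by
    rw [← mul_assoc, (Unitary.mem_iff.1 (hV i)).1, one_mul]
  have hleft : ∀ i j, V i * ρ * star (V i) = R →
      V i * ρ * star (V j) = R * (V i * star (V j)) := by
    rintro i j rfl; simp only [mul_assoc, hc]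
  have hright : ∀ i j, V j * ρ * star (V j) = R →
      V i * ρ * star (V j) = (V i * star (V j)) * R := by
    rintro i j rfl; simp only [mul_assoc, hc]
  rw [Ring.lie_def] at h ⊢
  conv_lhs =>
    rw [show V i * ρ * star (V j) * (V k * ρ * star (V l))
        = R * (V i * star (V j)) * ((V k * star (V l)) * R) by
          rw [hleft i j hi, hright k l hl],
      show V k * ρ * star (V l) * (V i * ρ * star (V j))
        = R * (V k * star (V l)) * ((V i * star (V j)) * R) by
          rw [hleft k l hk, hright i j hj]]
  rw [← h]
  noncomm_ring

end PureDephasing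

/-! ### Joint diagonalisation of commuting blocks. -/

namespace PureDephasing

open scoped Matrix ComplexOrder
open Filter Topology InnerProductSpace

variable {ι E : Type*} [NormedAddCommGroup E] [InnerProductSpace ℂ E] [CompleteSpace E]

open Module.End in
/-- A commuting family of symmetric operators, each vanishing on the kernel of a compact
self-adjoint operator that commutes with the family, has a total set of joint eigenvectors. -/
lemma orthogonal_iSup_iInf_eigenspace_eq_bot {κ : Type*} {T : κ → E →ₗ[ℂ] E}
    (hT : ∀ k, (T k).IsSymmetric) (hcomm : ∀ k l, Commute (T k) (T l))
    {R : E →L[ℂ] E} (hRc : IsCompactOperator R) (hRs : (R : E →ₗ[ℂ] E).IsSymmetric)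
    (hRT : ∀ k, Commute (R : E →ₗ[ℂ] E) (T k)) (hker : ∀ k x, R x = 0 → T k x = 0) :
    (⨆ χ : κ → ℂ, ⨅ k, eigenspace (T k) (χ k))ᗮ = ⊥ := by
  rw [eq_bot_iff, ← ContinuousLinearMap.orthogonalComplement_iSup_eigenspaces_eq_bot hRc hRs]
  refine Submodule.orthogonal_le (iSup_le fun μ => ?_)
  -- The kernel of `R`, possibly infinite-dimensional, lies in the joint eigenspace for `χ = 0`. The
  -- other eigenspaces are finite-dimensional, where commuting symmetric operators are jointly
  -- diagonalisable.
  by_cases hμ : μ = 0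
  · subst hμ
    refine le_iSup_of_le 0 (le_iInf fun k x hx => ?_)
    rw [mem_eigenspace_iff] at hx ⊢
    simpa using hker k x (by simpa using hx)
  · have hfin : FiniteDimensional ℂ (eigenspace (R : E →ₗ[ℂ] E) μ) :=
      ContinuousLinearMap.finite_dimensional_eigenspace hRc μ hμ
    set G := eigenspace (R : E →ₗ[ℂ] E) μ
    have hmaps : ∀ k, ∀ x ∈ G, T k x ∈ G := fun k => mapsTo_genEigenspace_of_comm (hRT k) μ 1
    have htop := LinearMap.IsSymmetric.iSup_iInf_eq_top_of_commute
      (T := fun k => (T k).restrict (hmaps k)) (fun k => (hT k).restrict_invariant (hmaps k))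
      (fun k l _ => LinearMap.ext fun x => Subtype.ext (LinearMap.congr_fun (hcomm k l) x.1))
    rw [← Submodule.map_subtype_top G, ← htop, Submodule.map_iSup]
    refine iSup_mono fun χ => ?_
    rintro _ ⟨x, hx, rfl⟩
    simp only [SetLike.mem_coe, Submodule.mem_iInf, mem_eigenspace_iff] at hx ⊢
    exact fun k => congrArg Subtype.val (hx k)

/-- Orthonormal bases of an orthogonal family with dense span form an orthonormal basis. -/
lemma exists_hilbertBasis_of_orthogonalFamily {κ : Type*} {F : κ → Submodule ℂ E}
    (hclosed : ∀ k, IsClosed (F k : Set E))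
    (hF : OrthogonalFamily ℂ (fun k => F k) fun k => (F k).subtypeₗᵢ)
    (hbot : (⨆ k, F k)ᗮ = ⊥) :
    ∃ (s : Set E) (e : HilbertBasis s ℂ E), ∀ n, ∃ k, e n ∈ F k := by
  have hcs : ∀ k, CompleteSpace (F k) := fun k => (hclosed k).completeSpace_coe
  choose w b hb using fun k => exists_hilbertBasis ℂ (F k)
  let v : (Σ k, w k) → E := fun a => (F a.1).subtypeₗᵢ (b a.1 a.2)
  have hv : Orthonormal ℂ v := hF.orthonormal_sigma_orthonormal fun k => (b k).orthonormal
  have hspan : (Submodule.span ℂ (Set.range v))ᗮ = ⊥ := by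
    rw [eq_bot_iff, ← hbot]
    intro x hx
    rw [← Submodule.iInf_orthogonal, Submodule.mem_iInf]
    refine fun k => (Submodule.mem_orthogonal' _ _).2 fun y hy => ?_
    have h : (innerSL ℂ x).comp (F k).subtypeL = 0 :=
      eq_of_forall_hilbertBasis (b k) fun n =>
        (Submodule.mem_orthogonal' _ _).1 hx _ (Submodule.subset_span ⟨⟨k, n⟩, rfl⟩)
    exact DFunLike.congr_fun h ⟨y, hy⟩
  obtain ⟨e, he⟩ := exists_hilbertBasis_subtype hv hspan
  refine ⟨_, e, fun n => ?_⟩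
  obtain ⟨a, ha⟩ := n.2
  exact ⟨a.1, by rw [he, ← ha]; exact (b a.1 a.2).2⟩

/-- A commuting family of compact operators, closed under adjoints and with common kernel bound,
is diagonal in a common orthonormal basis. -/
lemma exists_joint_eigenbasis {σ : ι → ι → E →L[ℂ] E} (hstar : ∀ i j, star (σ i j) = σ j i)
    (hcomm : ∀ i j k l, Commute (σ i j) (σ k l)) {o : ι} (hc : IsCompactOperator (σ o o))
    (hker : ∀ i j x, σ o o x = 0 → σ i j x = 0) :
    ∃ (s : Set E) (e : HilbertBasis s ℂ E), ∀ n i j, ∃ a : ℂ, σ i j (e n) = a • e n := by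
  -- Up to scalar factors these are the real and imaginary parts of the blocks: self-adjoint
  -- operators, from which `σ i j` is recovered as `(A (.inl (i, j)) - I • A (.inr (i, j))) / 2`.
  let A : (ι × ι) ⊕ (ι × ι) → E →L[ℂ] E :=
    Sum.elim (fun p => σ p.1 p.2 + σ p.2 p.1) (fun p => Complex.I • (σ p.1 p.2 - σ p.2 p.1))
  have hAsa : ∀ k, IsSelfAdjoint (A k) := by
    rintro (p | p)
    · simp [A, IsSelfAdjoint, hstar, add_comm]
    · simp [A, IsSelfAdjoint, hstar, ← smul_neg]
  have hσA : ∀ i j k, Commute (σ i j) (A k) := by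
    rintro i j (p | p)
    · exact (hcomm _ _ _ _).add_right (hcomm _ _ _ _)
    · exact ((hcomm _ _ _ _).sub_right (hcomm _ _ _ _)).smul_right _
  have hAA : ∀ k l, Commute (A k) (A l) := by
    rintro (p | p) l
    · exact (hσA _ _ l).add_left (hσA _ _ l)
    · exact ((hσA _ _ l).sub_left (hσA _ _ l)).smul_left _
  have hto : ∀ S T : E →L[ℂ] E, Commute S T → Commute (S : E →ₗ[ℂ] E) (T : E →ₗ[ℂ] E) :=
    fun S T h => LinearMap.ext fun x => DFunLike.congr_fun h x
  have hAker : ∀ k x, σ o o x = 0 → A k x = 0 := by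
    rintro (p | p) x hx <;> simp [A, hker _ _ x hx]
  have hsymm : ∀ k, (A k : E →ₗ[ℂ] E).IsSymmetric := fun k => (hAsa k).isSymmetric
  have hbot := orthogonal_iSup_iInf_eigenspace_eq_bot (T := fun k => (A k : E →ₗ[ℂ] E))
    hsymm (fun k l => hto _ _ (hAA k l)) hc
    (ContinuousLinearMap.isSelfAdjoint_iff_isSymmetric.1 (hstar o o))
    (fun k => hto _ _ (hσA o o k)) hAker
  have hclosed : ∀ χ : (ι × ι) ⊕ (ι × ι) → ℂ, IsClosed
      ((⨅ k, Module.End.eigenspace (A k : E →ₗ[ℂ] E) (χ k) : Submodule ℂ E) : Set E) := by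
    intro χ
    simp only [Submodule.coe_iInf]
    refine isClosed_iInter fun k => ?_
    have : (Module.End.eigenspace (A k : E →ₗ[ℂ] E) (χ k) : Set E)
        = {x | A k x = χ k • x} := by
      ext x; simp
    rw [this]
    exact isClosed_eq (A k).continuous (continuous_const_smul _)
  obtain ⟨s, e, he⟩ := exists_hilbertBasis_of_orthogonalFamily hclosed
    (LinearMap.IsSymmetric.orthogonalFamily_iInf_eigenspaces hsymm) hbot
  refine ⟨s, e, fun n i j => ?_⟩
  obtain ⟨χ, hχ⟩ := he n
  simp only [Submodule.mem_iInf, Module.End.mem_eigenspace_iff] at hχ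
  have h1 : σ i j (e n) + σ j i (e n) = χ (.inl (i, j)) • e n := hχ (.inl (i, j))
  have h2 : Complex.I • (σ i j (e n) - σ j i (e n)) = χ (.inr (i, j)) • e n :=
    hχ (.inr (i, j))
  refine ⟨(χ (.inl (i, j)) - Complex.I * χ (.inr (i, j))) / 2, ?_⟩
  have h3 : (2 : ℂ) • σ i j (e n)
      = (χ (.inl (i, j)) - Complex.I * χ (.inr (i, j))) • e n := by
    rw [sub_smul, mul_smul, ← h1, ← h2, smul_smul, Complex.I_mul_I, two_smul]
    module
  rw [div_eq_inv_mul, mul_smul, ← h3, smul_smul, inv_mul_cancel₀ two_ne_zero, one_smul]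

section evolved

variable [Fintype ι] [DecidableEq ι] {V : ι → E →L[ℂ] E} {ρ : E →L[ℂ] E} {c : ι → ℂ}

/-- In a joint eigenbasis `P n * σ i j * P n = σ i j * P n` with `P n = |e n⟩⟨e n|`. These terms sum
in norm to `σ i j`, which is a bounded operator times a Hilbert–Schmidt one. -/
lemma isZeroDiscord_of_lie_eq_zero (hV : ∀ i, V i ∈ unitary (E →L[ℂ] E)) (hρ : IsDensityOp ρ)
    (hc : c ≠ 0)
    (h : ∀ i ∈ Function.support c, ∀ j ∈ Function.support c, ∀ k ∈ Function.support c,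
      ∀ l ∈ Function.support c, ⁅V i * ρ * star (V j), V k * ρ * star (V l)⁆ = 0) :
    IsZeroDiscordEtoS (evolvedState V (pureState c) ρ) := by
  obtain ⟨o, ho⟩ := Function.ne_iff.1 hc
  replace ho : c o ≠ 0 := ho
  set σ := evolvedState V (pureState c) ρ with hσ
  have happ : ∀ i j, σ i j = (c i * star (c j)) • (V i * ρ * star (V j)) := fun i j =>
    evolvedState_apply V _ ρ i j
  have hρs : star ρ = ρ := hρ.1.isSelfAdjoint.star_eq
  have hl : ∀ i (x : E →L[ℂ] E), star (V i) * (V i * x) = x := fun i x => by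
    rw [← mul_assoc, (Unitary.mem_iff.1 (hV i)).1, one_mul]
  have hcompact : IsCompactOperator (σ o o) := by
    rw [happ]
    exact ((hρ.isCompactOperator.clm_comp (V o)).comp_clm (star (V o))).smul _
  have hcommA : ∀ i j k l, c i ≠ 0 → c j ≠ 0 → c k ≠ 0 → c l ≠ 0 →
      Commute (V i * ρ * star (V j)) (V k * ρ * star (V l)) := fun i j k l hi hj hk hl =>
    commute_iff_lie_eq.2 (h i hi j hj k hk l hl)
  have hcomm : ∀ i j k l, Commute (σ i j) (σ k l) := by
    intro i j k l
    rw [happ, happ]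
    by_cases hi : c i = 0
    · simp [hi]
    by_cases hj : c j = 0
    · simp [hj]
    by_cases hk : c k = 0
    · simp [hk]
    by_cases hl : c l = 0
    · simp [hl]
    exact ((hcommA i j k l hi hj hk hl).smul_left _).smul_right _
  have hker : ∀ i j x, σ o o x = 0 → σ i j x = 0 := by
    intro i j x hx
    rw [happ] at hx ⊢
    by_cases hi : c i = 0
    · simp [hi]
    by_cases hj : c j = 0
    · simp [hj]
    have hx0 : (V o * ρ * star (V o)) x = 0 := by
      have : c o * star (c o) ≠ 0 := mul_ne_zero ho (star_ne_zero.2 ho)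
      rw [smul_apply, smul_eq_zero] at hx
      exact hx.resolve_left this
    -- The left side is `V j * ρ ^ 2 * star (V j)`, the product of the blocks `(j, o)` and `(o, j)`;
    -- in the opposite order that product is the right side.
    have hprod : star (V i * ρ * star (V j)) * (V i * ρ * star (V j))
        = V o * ρ * star (V o) * (V o * ρ * star (V o)) := by
      have h1 : star (V i * ρ * star (V j)) = V j * ρ * star (V i) := by
        simp only [star_mul, star_star, hρs, mul_assoc]
      have h2 := (hcommA j o o j hj ho ho hj).eq
      rw [h1]
      simp only [mul_assoc, hl] at h2 ⊢
      exact h2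
    have hzero : (V i * ρ * star (V j)) x = 0 := by
      rw [← inner_self_eq_zero (𝕜 := ℂ), ← ContinuousLinearMap.adjoint_inner_right,
        ← ContinuousLinearMap.star_eq_adjoint, ← mul_apply_eq_comp, hprod, mul_apply_eq_comp,
        hx0, map_zero, inner_zero_right]
    rw [smul_apply, hzero, smul_zero]
  obtain ⟨s, e, he⟩ := exists_joint_eigenbasis (star_evolvedState hρs) hcomm hcompact hker
  refine ⟨s, e, ?_⟩
  obtain ⟨T, hT, hTs⟩ := hρ.exists_sqrt
  refine Pi.hasSum.2 fun i => Pi.hasSum.2 fun j => ?_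
  simp only [tensorOp_one_mul_mul_apply]
  have hdiag : ∀ n, rankOne ℂ (e n) (e n) * σ i j * rankOne ℂ (e n) (e n)
      = σ i j * rankOne ℂ (e n) (e n) := fun n =>
    let ⟨_, ha⟩ := he n i j
    conj_rankOne_eq (e.orthonormal.1 n) ha
  -- `T * star (V j)` is Hilbert–Schmidt in `e` because `T` is so in the rotated basis `star (V j)
  -- (e n)`.
  obtain ⟨e', he'⟩ := exists_hilbertBasis_unitary e (Unitary.star_mem (hV j))
  have hsum : Summable fun n => ‖(T * star (V j)) (e n)‖ ^ 2 := by
    simpa [he'] using hTs e'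
  have hfac : σ i j = ((c i * star (c j)) • (V i * T)) * (T * star (V j)) := by
    rw [happ, ← hT, smul_mul_assoc]; simp only [mul_assoc]
  have := (hasSum_mul_rankOne e hsum).mul_left ((c i * star (c j)) • (V i * T))
  rw [← hfac] at this
  refine (congrArg (fun f => HasSum f (σ i j)) (funext fun n => ?_)).mpr this
  rw [hdiag, hfac, mul_assoc]

end evolved

end PureDephasing

/-! ### Dephased states as convex series of product states. -/

namespace PureDephasing

open scoped Matrix ComplexOrder
open Filter Topology InnerProductSpace

/-- A countable or uncountable convex series of points of `s` lies in the closed convex hull. -/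
lemma mem_closure_convexHull_of_hasSum {X κ : Type*} [AddCommGroup X] [Module ℝ X]
    [TopologicalSpace X] [ContinuousSMul ℝ X] {s : Set X} {p : κ → ℝ} {x : κ → X} {y : X}
    (hp : ∀ n, 0 ≤ p n) (hp1 : HasSum p 1) (hx : ∀ n, p n ≠ 0 → x n ∈ s)
    (hy : HasSum (fun n => p n • x n) y) : y ∈ closure (convexHull ℝ s) := by
  classical
  -- Finite partial sums need not have total weight one, so they are normalised to centres of mass;
  -- the limit is unchanged because the weights sum to one.
  have hlim : Tendsto (fun t : Finset κ => t.centerMass p x) atTop (𝓝 y) := by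
    have := (hp1.inv₀ one_ne_zero).smul hy
    simpa [Finset.centerMass] using this
  refine mem_closure_of_tendsto hlim ?_
  have hpos : ∀ᶠ t : Finset κ in atTop, 0 < ∑ n ∈ t, p n := hp1.eventually_const_lt one_pos
  filter_upwards [hpos] with t ht
  rw [← Finset.centerMass_filter_ne_zero]
  refine Finset.centerMass_mem_convexHull _ (fun n _ => hp n) ?_
    fun n hn => hx n (Finset.mem_filter.1 hn).2
  rwa [Finset.sum_filter_ne_zero]

variable {ι E : Type*} [NormedAddCommGroup E] [InnerProductSpace ℂ E]

lemma isDensityOp_rankOne {e : E} (he : ‖e‖ = 1) : IsDensityOp (rankOne ℂ e e) := by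
  refine ⟨isPositive_rankOne_self e, fun s b => ?_⟩
  have h := b.hasSum_inner_mul_inner e e
  rw [inner_self_eq_norm_sq_to_K, he] at h
  simpa [inner_smul_right] using h

lemma rankOne_mul_mul_rankOne (e : E) (A : E →L[ℂ] E) :
    rankOne ℂ e e * A * rankOne ℂ e e = inner ℂ e (A e) • rankOne ℂ e e := by
  ext x
  simp only [mul_apply_eq_comp, rankOne_apply, smul_apply, map_smul, smul_smul]
  rw [mul_comm]

variable [CompleteSpace E] [Fintype ι] [DecidableEq ι] {V : ι → E →L[ℂ] E} {ρ : E →L[ℂ] E}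
  {c : ι → ℂ}

/-- The unnormalised state of the system conditioned on the environment vector `e`. -/
noncomputable def conditionalMatrix (σ : JointOp ι E) (e : E) : Matrix ι ι ℂ :=
  Matrix.of fun i j => inner ℂ e (σ i j e)

/-- The quadratic form at `z` is the expectation of `ρ` in `∑ i, (z i * star (c i)) • star (V i) e`.
-/
lemma posSemidef_conditionalMatrix (hρ : ρ.IsPositive) (e : E) :
    (conditionalMatrix (evolvedState V (pureState c) ρ) e).PosSemidef := by
  have happ : ∀ i j, conditionalMatrix (evolvedState V (pureState c) ρ) e i j
      = c i * star (c j) * inner ℂ (star (V i) e) (ρ (star (V j) e)) := by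
    intro i j
    simp only [conditionalMatrix, Matrix.of_apply, evolvedState_apply, pureState_apply, smul_apply,
      inner_smul_right, mul_apply_eq_comp, ContinuousLinearMap.star_eq_adjoint,
      ContinuousLinearMap.adjoint_inner_left]
  refine Matrix.PosSemidef.of_dotProduct_mulVec_nonneg ?_ fun z => ?_
  · ext i j
    rw [Matrix.conjTranspose_apply, happ, happ, star_mul, star_mul, star_star,
      ← hρ.inner_left_eq_inner_right]
    rw [show star (inner ℂ (ρ (star (V j) e)) (star (V i) e))
      = inner ℂ (star (V i) e) (ρ (star (V j) e)) from inner_conj_symm _ _]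
    ring
  · have : star z ⬝ᵥ (conditionalMatrix (evolvedState V (pureState c) ρ) e) *ᵥ z
        = inner ℂ (∑ i, (z i * star (c i)) • star (V i) e)
            (ρ (∑ i, (z i * star (c i)) • star (V i) e)) := by
      simp only [dotProduct, Matrix.mulVec, happ, map_sum, sum_inner, inner_sum, map_smul,
        inner_smul_left, inner_smul_right, Finset.mul_sum, Pi.star_apply]
      rw [Finset.sum_comm]
      refine Finset.sum_congr rfl fun i _ => Finset.sum_congr rfl fun j _ => ?_
      simp only [← RCLike.star_def, star_mul, star_star]
      ring
    rw [this]
    exact hρ.inner_nonneg_right _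

/-- Each `star (V i)` carries the basis to another one, so the `i`-th diagonal block contributes `‖c
i‖ ^ 2` times the trace of `ρ`. -/
lemma hasSum_trace_conditionalMatrix (hV : ∀ i, V i ∈ unitary (E →L[ℂ] E)) (hρ : IsDensityOp ρ)
    (hc : ∑ i, ‖c i‖ ^ 2 = 1) {κ : Type*} (b : HilbertBasis κ ℂ E) :
    HasSum (fun n => (conditionalMatrix (evolvedState V (pureState c) ρ) (b n)).trace) 1 := by
  have h : HasSum (fun n => ∑ i, c i * star (c i) *
      inner ℂ (star (V i) (b n)) (ρ (star (V i) (b n)))) (∑ i, c i * star (c i) * 1) :=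
    hasSum_sum fun i _ => (hρ.hasSum_inner_unitary b (Unitary.star_mem (hV i))).mul_left _
  have hone : ∑ i, c i * star (c i) * 1 = 1 := by
    have h2 : ∀ i, c i * star (c i) * 1 = ((‖c i‖ ^ 2 : ℝ) : ℂ) := fun i => by
      rw [mul_one, RCLike.star_def, Complex.mul_conj, Complex.normSq_eq_norm_sq]
    rw [Finset.sum_congr rfl fun i _ => h2 i, ← Complex.ofReal_sum, hc, Complex.ofReal_one]
  rw [hone] at h
  refine (congrArg (fun f => HasSum f (1 : ℂ)) (funext fun n => ?_)).mpr h
  refine Finset.sum_congr rfl fun i _ => ?_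
  simp only [Matrix.diag_apply, conditionalMatrix, Matrix.of_apply, evolvedState_apply,
    pureState_apply, smul_apply, inner_smul_right, mul_apply_eq_comp,
    ContinuousLinearMap.star_eq_adjoint, ContinuousLinearMap.adjoint_inner_left]

/-- Dephasing in an orthonormal basis of the environment exhibits a state as a convex series of
product states. -/
lemma IsZeroDiscordEtoS.isSeparableState (hV : ∀ i, V i ∈ unitary (E →L[ℂ] E))
    (hρ : IsDensityOp ρ) (hc : ∑ i, ‖c i‖ ^ 2 = 1)
    (h : IsZeroDiscordEtoS (evolvedState V (pureState c) ρ)) :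
    IsSeparableState (evolvedState V (pureState c) ρ) := by
  obtain ⟨s, e, he⟩ := h
  set σ := evolvedState V (pureState c) ρ
  have hpsd := fun n => posSemidef_conditionalMatrix (V := V) (c := c) hρ.1 (e n)
  have hsum := hasSum_trace_conditionalMatrix hV hρ hc e
  set a := fun n => conditionalMatrix σ (e n)
  have htr : ∀ n, (((a n).trace.re : ℝ) : ℂ) = (a n).trace := fun n =>
    (Complex.eq_re_of_ofReal_le (r := 0) (by simpa using (hpsd n).trace_nonneg)).symm
  refine mem_closure_convexHull_of_hasSum (p := fun n => (a n).trace.re)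
    (x := fun n => tensorOp ((a n).trace⁻¹ • a n) (rankOne ℂ (e n) (e n)))
    (fun n => (Complex.le_def.1 (hpsd n).trace_nonneg).1) (by simpa using Complex.hasSum_re hsum)
    (fun n hn => ?_) ?_
  · refine ⟨_, _, ⟨(hpsd n).smul ?_, ?_⟩, isDensityOp_rankOne (e.orthonormal.1 n), rfl⟩
    · exact inv_nonneg.2 (hpsd n).trace_nonneg
    · rw [Matrix.trace_smul, smul_eq_mul, inv_mul_cancel₀]
      intro h0
      exact hn (by simp only [h0, Complex.zero_re])
  · refine (congrArg (fun f => HasSum f σ) (funext fun n => ?_)).mpr he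
    ext1 i j
    rw [tensorOp_one_mul_mul_apply, rankOne_mul_mul_rankOne]
    change (a n).trace.re • (((a n).trace⁻¹ • a n) i j • rankOne ℂ (e n) (e n))
      = a n i j • rankOne ℂ (e n) (e n)
    rw [← Complex.coe_smul, htr, Matrix.smul_apply, smul_eq_mul, smul_smul]
    -- A positive matrix of trace zero vanishes, so the meaningless normalisation does no harm
    -- there.
    by_cases h0 : (a n).trace = 0
    · have : a n = 0 := (hpsd n).trace_eq_zero_iff.1 h0
      simp [this]
    · rw [mul_inv_cancel_left₀ h0]

end PureDephasing

/-! ### The cycle of implications. -/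

theorem theorem2 {ι E : Type*} [Fintype ι] [DecidableEq ι]
    [NormedAddCommGroup E] [InnerProductSpace ℂ E] [CompleteSpace E]
    (V : ι → E →L[ℂ] E) (hV : ∀ i, V i ∈ unitary (E →L[ℂ] E))
    (ρE : E →L[ℂ] E) (hρE : PureDephasing.IsDensityOp ρE)
    (c : ι → ℂ) (hc : ∑ i, ‖c i‖ ^ 2 = 1) :
    List.TFAE [
      PureDephasing.IsSeparableState
        (PureDephasing.evolvedState V (PureDephasing.pureState c) ρE),
      PureDephasing.IsZeroDiscordEtoS
        (PureDephasing.evolvedState V (PureDephasing.pureState c) ρE),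
      ∀ i ∈ Function.support c, ∀ j ∈ Function.support c,
        ∀ k ∈ Function.support c, ∀ l ∈ Function.support c,
          ⁅V i * ρE * star (V j), V k * ρE * star (V l)⁆ = 0,
      ∃ R : E →L[ℂ] E,
        (∀ i ∈ Function.support c, V i * ρE * star (V i) = R) ∧
        ∀ i ∈ Function.support c, ∀ j ∈ Function.support c,
          ∀ k ∈ Function.support c, ∀ l ∈ Function.support c,
            R * ⁅V i * star (V j), V k * star (V l)⁆ * R = 0] := by
  have hc0 : c ≠ 0 := by
    rintro rfl
    simp at hc
  tfae_have 1 → 4 := by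
    intro h
    obtain ⟨o, ho⟩ := Function.ne_iff.1 hc0
    have htwist : ∀ i ∈ Function.support c, ∀ j ∈ Function.support c, ∀ k ∈ Function.support c,
        V i * ρE * star (V j) = V k * ρE * star (V j) * (V i * star (V k)) :=
      fun i hi j hj k hk => h.twist hV hρE hi hj hk
    -- The twist relation with `j = i` cancels the inner unitaries.
    have hR : ∀ i ∈ Function.support c, V i * ρE * star (V i) = V o * ρE * star (V o) := by
      intro i hi
      rw [htwist i hi i hi o ho, mul_assoc _ (star (V i)), ← mul_assoc (star (V i)),
        (Unitary.mem_iff.1 (hV i)).1, one_mul]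
    refine ⟨_, hR, fun i hi j hj k hk l hl => ?_⟩
    -- The left factor `R` alone already annihilates the commutator.
    rw [PureDephasing.mul_lie_mul_eq_zero_of_twist hV htwist hR i hi j hj k hk l hl, zero_mul]
  tfae_have 4 → 3 := by
    rintro ⟨R, hR, h⟩ i hi j hj k hk l hl
    exact PureDephasing.lie_eq_zero_of_mul_lie_mul hV (hR i hi) (hR j hj) (hR k hk) (hR l hl)
      (h i hi j hj k hk l hl)
  tfae_have 3 → 2 := PureDephasing.isZeroDiscord_of_lie_eq_zero hV hρE hc0
  tfae_have 2 → 1 := fun h => h.isSeparableState hV hρE hc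
  tfae_finish
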